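/- Let $(e_i)_{i\in\mathbb Z}$ be an orthonormal basis of $\ell^2(\mathbb Z)$ and, for a bounded linear operator $A$ on $\ell^2(\mathbb Z)$, put $A_{i,j}=\langle Ae_j,e_i\rangle$. Let $\sigma\in(0,1]$ and $U_{-1}=\{1\}$, $U_0=\{0\}$, $U_1=\{\sigma,-\sigma\}$. Let $A\in\Psi E(U_{-1},U_0,U_1)$ be pseudo-ergodic, which means: $A$ is a bounded linear operator on $\ell^2(\mathbb Z)$ with $A_{i+k,i}\in U_k$ for $k\in\{-1,0,1\}$ and $A_{i+k,i}=0$ for all other $k$ (for all $i\in\mathbb Z$), and for every $\varepsilon>0$, every $N\ge 1$ and every matrix $B\in\mathbb C^{N\times N}$ with $B_{i,j}\in U_{i-j}$ if $|i-j|\le 1$ and $B_{i,j}=0$ otherwise, there is $k\in\mathbb Z$ with $\bigl\|(A_{k+i,k+j})_{0\le i,j<N}-B\bigr\|\le\varepsilon$, where rows and columns of $B$ are numbered $0,\dots,N-1$ and $\|\cdot\|$ is the operator norm induced by the Euclidean norm. Let $$N(A)=\operatorname{clos}\{\langle Ax,x\rangle : x\in\ell^2(\mathbb Z),\ \|x\|=1\}$$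 be the (closed) numerical range of $A$. Then $$N(A)=\{x+iy\in\mathbb C : -f(x)\le y\le f(x),\ -(1+\sigma)\le x\le 1+\sigma\},$$ where $f\colon[-(1+\sigma),1+\sigma]\to\mathbb R$ is given by $$f(x)=\begin{cases} (1-\sigma)\sqrt{1-\bigl(\tfrac{x}{1+\sigma}\bigr)^2} & \text{for } x\in\Bigl[-(1+\sigma),-\tfrac{(1+\sigma)^2}{\sqrt{2(1+\sigma^2)}}\Bigr],\\ \sqrt{2(1+\sigma^2)}+x & \text{for } x\in\Bigl(-\tfrac{(1+\sigma)^2}{\sqrt{2(1+\sigma^2)}},-\tfrac{(1-\sigma)^2}{\sqrt{2(1+\sigma^2)}}\Bigr],\\ (1+\sigma)\sqrt{1-\bigl(\tfrac{x}{1-\sigma}\bigr)^2} & \text{for } x\in\Bigl(-\tfrac{(1-\sigma)^2}{\sqrt{2(1+\sigma^2)}},\tfrac{(1-\sigma)^2}{\sqrt{2(1+\sigma^2)}}\Bigr),\\ \sqrt{2(1+\sigma^2)}-x & \text{for } x\in\Bigl[\tfrac{(1-\sigma)^2}{\sqrt{2(1+\sigma^2)}},\tfrac{(1+\sigma)^2}{\sqrt{2(1+\sigma^2)}}\Bigr)\text{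 not covered above},\\ (1-\sigma)\sqrt{1-\bigl(\tfrac{x}{1+\sigma}\bigr)^2} & \text{for } x\in\Bigl[\tfrac{(1+\sigma)^2}{\sqrt{2(1+\sigma^2)}},1+\sigma\Bigr] \end{cases}$$ (for $\sigma=1$ the third case is empty). Moreover, $N(A)$ is the convex hull of the union of the two ellipses $\{e^{i\theta}+\sigma e^{-i\theta}:\theta\in[0,2\pi)\}$ and $\{e^{i\theta}-\sigma e^{-i\theta}:\theta\in[0,2\pi)\}$. -/

import Mathlib

/-- The Hilbert space `ℓ²(ℤ)` of square-summable two-sided complex sequences. -/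
abbrev EllTwo : Type := lp (fun _ : ℤ => ℂ) 2

/-- The entry `A_{i,j} = ⟨A e_j, e_i⟩` of a bounded operator on `ℓ²(ℤ)` with respect to the
orthonormal basis `e`. (Mathlib's inner product is conjugate-linear in its first argument.) -/
noncomputable def entry (e : HilbertBasis ℤ ℂ EllTwo) (A : EllTwo →L[ℂ] EllTwo) (i j : ℤ) : ℂ :=
  inner ℂ (e i) (A (e j))

/-- `AllowedEntry n m U k a`: the number `a` may stand on the `k`-th diagonal, that is, `a ∈ U k`
if `n ≤ k ≤ m`, and `a = 0` otherwise. -/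
def AllowedEntry (n m : ℤ) (U : ℤ → Set ℂ) (k : ℤ) (a : ℂ) : Prop :=
  (n ≤ k ∧ k ≤ m → a ∈ U k) ∧ (¬ (n ≤ k ∧ k ≤ m) → a = 0)

/-- `M(U_n, …, U_m)`: the bounded operators on `ℓ²(ℤ)` whose `k`-th diagonal `(A_{i+k,i})_i` has
its entries in `U_k` for `n ≤ k ≤ m` and vanishes for all other `k`. -/
def bandOperators (e : HilbertBasis ℤ ℂ EllTwo) (n m : ℤ) (U : ℤ → Set ℂ) :
    Set (EllTwo →L[ℂ] EllTwo) :=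
  {A | ∀ k i : ℤ, AllowedEntry n m U k (entry e A (i + k) i)}

/-- `M_fin(U_n, …, U_m)`, the part of size `N × N`: the `k`-th diagonal consists of the entries
`B i j` with `i - j = k`. -/
def finiteBandMatrices (n m : ℤ) (U : ℤ → Set ℂ) (N : ℕ) : Set (Matrix (Fin N) (Fin N) ℂ) :=
  {B | ∀ i j : Fin N, AllowedEntry n m U ((i : ℤ) - (j : ℤ)) (B i j)}

/-- The matrix of the compression `P_{k,l} A P_{k,l}` with `l = k + N - 1`, where `P_{k,l}` is the
orthogonal projection onto `span {e_k, …, e_l}`, with rows and columns renumbered from `0`. -/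
noncomputable def finiteSection (e : HilbertBasis ℤ ℂ EllTwo) (A : EllTwo →L[ℂ] EllTwo)
    (k : ℤ) (N : ℕ) : Matrix (Fin N) (Fin N) ℂ :=
  Matrix.of fun i j => entry e A (k + (i : ℤ)) (k + (j : ℤ))

/-- `ΨE(U_n, …, U_m)`, the pseudo-ergodic operators: those `A ∈ M(U_n, …, U_m)` such that for every
`ε > 0` every finite square matrix in `M_fin(U_n, …, U_m)` is found, up to `ε` in the Euclidean
operator norm, along the diagonal of `A`. -/
def pseudoErgodic (e : HilbertBasis ℤ ℂ EllTwo) (n m : ℤ) (U : ℤ → Set ℂ) :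
    Set (EllTwo →L[ℂ] EllTwo) :=
  {A | A ∈ bandOperators e n m U ∧
    ∀ ε : ℝ, 0 < ε → ∀ N : ℕ, ∀ B ∈ finiteBandMatrices n m U N,
      ∃ k : ℤ, ‖Matrix.toEuclideanCLM (𝕜 := ℂ) (finiteSection e A k N - B)‖ ≤ ε}

/-- The (closed) numerical range `N(A) = clos {⟨A x, x⟩ : ‖x‖ = 1}`. -/
def numericalRange (A : EllTwo →L[ℂ] EllTwo) : Set ℂ :=
  closure {z : ℂ | ∃ x : EllTwo, ‖x‖ = 1 ∧ z = inner ℂ x (A x)}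

/-- The sets `U_{-1} = {1}`, `U_0 = {0}`, `U_1 = {σ, -σ}`; all other values are irrelevant. -/
def hoppingSets (σ : ℝ) (k : ℤ) : Set ℂ :=
  if k = -1 then {1} else if k = 0 then {0} else if k = 1 then {(σ : ℂ), -(σ : ℂ)} else ∅

/-- The piecewise boundary function `f`; only its values on `[-(1+σ), 1+σ]` are used. -/
noncomputable def boundaryFn (σ x : ℝ) : ℝ :=
  if x ≤ -((1 + σ) ^ 2 / Real.sqrt (2 * (1 + σ ^ 2))) then
    (1 - σ) * Real.sqrt (1 - (x / (1 + σ)) ^ 2)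
  else if x ≤ -((1 - σ) ^ 2 / Real.sqrt (2 * (1 + σ ^ 2))) then
    Real.sqrt (2 * (1 + σ ^ 2)) + x
  else if x < (1 - σ) ^ 2 / Real.sqrt (2 * (1 + σ ^ 2)) then
    (1 + σ) * Real.sqrt (1 - (x / (1 - σ)) ^ 2)
  else if x < (1 + σ) ^ 2 / Real.sqrt (2 * (1 + σ ^ 2)) then
    Real.sqrt (2 * (1 + σ ^ 2)) - x
  else
    (1 - σ) * Real.sqrt (1 - (x / (1 + σ)) ^ 2)

/-- The ellipse `{e^{iθ} + s e^{-iθ} : θ ∈ [0, 2π)}`. -/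
noncomputable def hoppingEllipse (s : ℝ) : Set ℂ :=
  (fun θ : ℝ => Complex.exp (θ * Complex.I) + (s : ℂ) * Complex.exp (-(θ * Complex.I))) ''
    Set.Ico 0 (2 * Real.pi)

/-! Let `c` be the coefficients of a unit vector `x`, let `s i = ±σ` be the subdiagonal and put `w i
= conj (c i) * c (i + 1)`. Grouping the two terms of each bond `(i, i + 1)` gives `⟨A x, x⟩ = ∑
hopMap (s i) (w i)`, and `∑ ‖w i‖ ≤ 1` by AM-GM. As `hopMap (±σ)` maps the unit disc onto one of the
two elliptic discs, the sum is a sub-convex combination of their points and lies in the closed hull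
(`sum_hopMap_mem_ellipseHull`).

Conversely, pseudo-ergodicity realises every finite sign pattern up to `ε`. Constant signs and plane
waves approximate the ellipses (`hoppingEllipse_subset_closure`), and placing two patterns side by
side gives convex combinations (`convex_finiteFormValues`).

The formula for `f` comes from support lines: in the first quadrant the hull is bounded by an arc of
each ellipse and their common tangent `x + y = √(2(1 + σ²))`. -/

open scoped ComplexConjugate

/-! ### Ellipses as linear images of the circle, and their hull -/

/-- The real-linear map `w ↦ w + s w̄`, which carries the unit circle onto `hoppingEllipse s`. -/
noncomputable def hopMap (s : ℝ) : ℂ →ₗ[ℝ] ℂ :=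
  LinearMap.id + s • Complex.conjAe.toLinearMap

theorem hopMap_apply (s : ℝ) (w : ℂ) : hopMap s w = w + s * (starRingEnd ℂ) w := by
  simp [hopMap]

theorem hopMap_re (s : ℝ) (w : ℂ) : (hopMap s w).re = (1 + s) * w.re := by
  simp [hopMap_apply]; ring

theorem hopMap_im (s : ℝ) (w : ℂ) : (hopMap s w).im = (1 - s) * w.im := by
  simp [hopMap_apply]; ring

theorem hopMap_exp (s θ : ℝ) : hopMap s (Complex.exp (θ * Complex.I)) =
    Complex.exp (θ * Complex.I) + (s : ℂ) * Complex.exp (-(θ * Complex.I)) := by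
  rw [hopMap_apply, ← Complex.exp_conj]
  simp

theorem continuous_hopMap (s : ℝ) : Continuous (hopMap s) :=
  LinearMap.continuous_of_finiteDimensional _

theorem hoppingEllipse_eq_image (s : ℝ) :
    hoppingEllipse s = hopMap s '' Metric.sphere 0 1 := by
  have hper : Function.Periodic (fun θ : ℝ => hopMap s (Complex.exp (θ * Complex.I)))
      (2 * Real.pi) := by
    intro θ
    simp only [Complex.ofReal_add, add_mul, Complex.ofReal_mul, Complex.ofReal_ofNat,
      Complex.exp_periodic (θ * Complex.I)]
  rw [← Complex.range_exp_mul_I, ← Set.range_comp]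
  apply Set.Subset.antisymm
  · rintro _ ⟨θ, _, rfl⟩
    exact ⟨θ, hopMap_exp s θ⟩
  · rintro _ ⟨θ, rfl⟩
    obtain ⟨η, hη, h⟩ := hper.exists_mem_Ico₀ Real.two_pi_pos θ
    exact ⟨η, hη, (hopMap_exp s η).symm.trans h.symm⟩

theorem convexHull_hoppingEllipse (s : ℝ) :
    convexHull ℝ (hoppingEllipse s) = hopMap s '' Metric.closedBall 0 1 := by
  rw [hoppingEllipse_eq_image, ← LinearMap.image_convexHull,
    convexHull_sphere_eq_closedBall (0 : ℂ) zero_le_one]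

theorem hoppingEllipse_nonempty (s : ℝ) : (hoppingEllipse s).Nonempty :=
  (Set.nonempty_Ico.2 Real.two_pi_pos).image _

/-- In a real normed space the convex hull of the union of two compact convex sets is compact. -/
theorem IsCompact.convexJoin {E : Type*} [NormedAddCommGroup E] [NormedSpace ℝ E] {S T : Set E}
    (hS : IsCompact S) (hT : IsCompact T) : IsCompact (convexJoin ℝ S T) := by
  have h : _root_.convexJoin ℝ S T = (fun p : ℝ × E × E => (1 - p.1) • p.2.1 + p.1 • p.2.2) ''
      (Set.Icc 0 1 ×ˢ (S ×ˢ T)) := by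
    ext z
    simp only [mem_convexJoin, segment_eq_image, Set.mem_image, Set.mem_prod, Prod.exists]
    constructor
    · rintro ⟨x, hx, y, hy, t, ht, rfl⟩
      exact ⟨t, x, y, ⟨ht, hx, hy⟩, rfl⟩
    · rintro ⟨t, x, y, ⟨ht, hx, hy⟩, rfl⟩
      exact ⟨x, hx, y, hy, t, ht, rfl⟩
  rw [h]
  exact (isCompact_Icc.prod (hS.prod hT)).image (by fun_prop)

/-- The convex hull of the two ellipses. -/
noncomputable def ellipseHull (σ : ℝ) : Set ℂ :=
  convexHull ℝ (hoppingEllipse σ ∪ hoppingEllipse (-σ))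

theorem convex_ellipseHull (σ : ℝ) : Convex ℝ (ellipseHull σ) := convex_convexHull ℝ _

theorem image_closedBall_subset_ellipseHull {σ s : ℝ} (hs : s = σ ∨ s = -σ) :
    hopMap s '' Metric.closedBall 0 1 ⊆ ellipseHull σ := by
  rw [← convexHull_hoppingEllipse]
  apply convexHull_mono
  rcases hs with rfl | rfl
  exacts [Set.subset_union_left, Set.subset_union_right]

theorem hopMap_mem_ellipseHull {σ s : ℝ} (hs : s = σ ∨ s = -σ) {w : ℂ} (hw : ‖w‖ ≤ 1) :
    hopMap s w ∈ ellipseHull σ :=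
  image_closedBall_subset_ellipseHull hs ⟨w, by simpa using hw, rfl⟩

theorem isClosed_ellipseHull (σ : ℝ) : IsClosed (ellipseHull σ) := by
  have hE : ∀ s, IsCompact (convexHull ℝ (hoppingEllipse s)) := fun s => by
    rw [convexHull_hoppingEllipse]
    exact (isCompact_closedBall 0 1).image (continuous_hopMap s)
  rw [ellipseHull, convexHull_union (hoppingEllipse_nonempty σ) (hoppingEllipse_nonempty (-σ))]
  exact ((hE σ).convexJoin (hE (-σ))).isClosed

/-- Sub-convex combinations of points of the two elliptic discs stay in the hull. -/
theorem sum_hopMap_mem_ellipseHull {ι : Type*} {σ : ℝ} (t : Finset ι) {s : ι → ℝ}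
    (hs : ∀ i, s i = σ ∨ s i = -σ) {w : ι → ℂ} (hw : ∑ i ∈ t, ‖w i‖ ≤ 1) :
    ∑ i ∈ t, hopMap (s i) (w i) ∈ ellipseHull σ := by
  have h0 : (0 : ℂ) ∈ ellipseHull σ := by
    simpa using hopMap_mem_ellipseHull (σ := σ) (Or.inl rfl) (w := 0) (by simp)
  -- The extra index `none` puts the missing mass `1 - ∑ ‖w i‖` at `0`; index `i` has weight `‖w i‖`
  -- at the image of the direction of `w i`.
  have key := (convex_ellipseHull σ).sum_mem (t := Finset.insertNone t)
    (w := fun o => o.elim (1 - ∑ i ∈ t, ‖w i‖) fun i => ‖w i‖)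
    (z := fun o => o.elim 0 fun i => hopMap (s i) ((‖w i‖⁻¹ : ℝ) • w i)) ?_ ?_ ?_
  · simp only [Finset.sum_insertNone, Option.elim_none, smul_zero, Option.elim_some,
      zero_add, ← map_smul] at key
    convert key using 3 with i
    rcases eq_or_ne (w i) 0 with h | h
    · simp [h]
    · rw [smul_smul, mul_inv_cancel₀ (norm_ne_zero_iff.2 h), one_smul]
  · rintro (_ | i) _
    · simpa using hw
    · simp
  · simp
  · rintro (_ | i) _
    · exact h0
    · refine hopMap_mem_ellipseHull (hs i) ?_
      rw [norm_smul, norm_inv, norm_norm]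
      exact inv_mul_le_one

/-! ### Upper bound: the numerical range lies in the hull -/

/-- The matrix of an operator in `M({1}, {0}, {σ, -σ})` is described by a sequence of signs. -/
theorem exists_subdiagonal {e : HilbertBasis ℤ ℂ EllTwo} {σ : ℝ} {A : EllTwo →L[ℂ] EllTwo}
    (hA : A ∈ bandOperators e (-1) 1 (hoppingSets σ)) :
    ∃ s : ℤ → ℝ, (∀ i, s i = σ ∨ s i = -σ) ∧
      ∀ i j, entry e A i j = if j = i + 1 then 1 else if i = j + 1 then (s j : ℂ) else 0 := by
  have hsub : ∀ i, ∃ s : ℝ, (s = σ ∨ s = -σ) ∧ entry e A (i + 1) i = s := by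
    intro i
    have h : entry e A (i + 1) i = σ ∨ entry e A (i + 1) i = -σ := by
      have h := (hA 1 i).1 (by norm_num)
      simpa [hoppingSets] using h
    rcases h with h | h
    · exact ⟨σ, Or.inl rfl, h⟩
    · exact ⟨-σ, Or.inr rfl, by simpa using h⟩
  choose s hs hes using hsub
  refine ⟨s, hs, fun i j => ?_⟩
  split_ifs with h1 h2
  · subst h1
    have h := (hA (-1) (i + 1)).1 (by norm_num)
    simpa [hoppingSets] using h
  · subst h2
    exact hes j
  · have h := hA (i - j) j
    rw [add_sub_cancel] at h
    by_cases hij : i = j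
    · subst hij
      have h := h.1 (by norm_num)
      simpa [hoppingSets] using h
    · exact h.2 (by omega)

theorem hasSum_norm_repr_sq (e : HilbertBasis ℤ ℂ EllTwo) (x : EllTwo) :
    HasSum (fun i => ‖e.repr x i‖ ^ 2) (‖x‖ ^ 2) := by
  have h := (Complex.hasSum_re (e.hasSum_inner_mul_inner x x))
  convert h using 1
  · ext i
    rw [← e.repr_apply_apply, ← inner_conj_symm, ← e.repr_apply_apply, ← Complex.normSq_eq_conj_mul_self]
    rw [Complex.ofReal_re, Complex.normSq_eq_norm_sq]
  · exact (inner_self_eq_norm_sq (𝕜 := ℂ) x).symm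

theorem inner_self_apply_mem_ellipseHull {e : HilbertBasis ℤ ℂ EllTwo} {σ : ℝ}
    {A : EllTwo →L[ℂ] EllTwo} (hA : A ∈ bandOperators e (-1) 1 (hoppingSets σ))
    {x : EllTwo} (hx : ‖x‖ = 1) : inner ℂ x (A x) ∈ ellipseHull σ := by
  obtain ⟨s, hs, hent⟩ := exists_subdiagonal hA
  set c : ℤ → ℂ := fun i => e.repr x i with hc
  have hc2 : HasSum (fun i => ‖c i‖ ^ 2) 1 := by
    simpa [hx] using hasSum_norm_repr_sq e x
  have hc2' : HasSum (fun i => ‖c (i + 1)‖ ^ 2) 1 :=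
    (Equiv.addRight (1 : ℤ)).hasSum_iff.2 hc2
  have hrow : ∀ i, inner ℂ (e i) (A x) = c (i + 1) + s (i - 1) * c (i - 1) := by
    intro i
    have h1 : HasSum (fun j => c j * entry e A i j) (inner ℂ (e i) (A x)) := by
      have := ((e.hasSum_repr x).mapL A).mapL (innerSL ℂ (e i))
      simpa [entry, inner_smul_right] using this
    have h2 := hasSum_sum_of_ne_finset_zero (f := fun j => c j * entry e A i j)
      (s := {i + 1, i - 1}) (L := .unconditional ℤ) (fun j hj => by
        simp only [Finset.mem_insert, Finset.mem_singleton, not_or] at hj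
        rw [hent, if_neg hj.1, if_neg (by omega), mul_zero])
    rw [h1.unique h2, Finset.sum_pair (by omega), hent, hent, if_pos rfl, if_neg (by omega),
      if_pos (by omega)]
    ring
  have hw : ∀ i, ‖conj (c i) * c (i + 1)‖ ≤ (‖c i‖ ^ 2 + ‖c (i + 1)‖ ^ 2) / 2 := by
    intro i
    rw [norm_mul, RCLike.norm_conj]
    linarith [two_mul_le_add_sq ‖c i‖ ‖c (i + 1)‖]
  have hbd : HasSum (fun i => (‖c i‖ ^ 2 + ‖c (i + 1)‖ ^ 2) / 2) 1 := by
    simpa using (hc2.add hc2').div_const 2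
  have hsw : Summable fun i => conj (c i) * c (i + 1) := hbd.summable.of_norm_bounded hw
  have hq : HasSum (fun i => conj (c i) * c (i + 1) + s (i - 1) * (conj (c i) * c (i - 1)))
      (inner ℂ x (A x)) := by
    have hterm : ∀ i, inner ℂ x (e i) * inner ℂ (e i) (A x) =
        conj (c i) * c (i + 1) + s (i - 1) * (conj (c i) * c (i - 1)) := by
      intro i
      rw [hrow, ← inner_conj_symm, ← e.repr_apply_apply]
      ring
    have h := e.hasSum_inner_mul_inner x (A x)
    rw [funext hterm] at h
    exact h
  -- The subdiagonal part is split off and shifted by one, so that `s i` meets `conj (w i)` in the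
  -- same summand as `w i`.
  have hq1 := hq.sub hsw.hasSum
  simp only [add_sub_cancel_left] at hq1
  have hq2 := (Equiv.addRight (1 : ℤ)).hasSum_iff.2 hq1
  have hq3 := hsw.hasSum.add hq2
  rw [add_sub_cancel] at hq3
  refine (isClosed_ellipseHull σ).mem_of_tendsto hq3 (Filter.Eventually.of_forall fun t => ?_)
  convert sum_hopMap_mem_ellipseHull t hs (w := fun i => conj (c i) * c (i + 1)) ?_ using 2 with i
  · simp only [hopMap_apply, Function.comp_apply, Equiv.coe_addRight, add_sub_cancel_right,
      map_mul, Complex.conj_conj]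
    ring
  · exact (Finset.sum_le_sum fun i _ => hw i).trans
      (sum_le_hasSum t (fun i _ => by positivity) hbd)

theorem numericalRange_subset_ellipseHull {e : HilbertBasis ℤ ℂ EllTwo} {σ : ℝ}
    {A : EllTwo →L[ℂ] EllTwo} (hA : A ∈ bandOperators e (-1) 1 (hoppingSets σ)) :
    numericalRange A ⊆ ellipseHull σ := by
  refine closure_minimal ?_ (isClosed_ellipseHull σ)
  rintro _ ⟨x, hx, rfl⟩
  exact inner_self_apply_mem_ellipseHull hA hx

/-! ### The hull in coordinates -/

theorem boundaryFn_neg {σ x : ℝ} (hσ : σ ∈ Set.Ioc (0 : ℝ) 1) (hx : 0 ≤ x) :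
    boundaryFn σ (-x) = boundaryFn σ x := by
  have hc : 0 < Real.sqrt (2 * (1 + σ ^ 2)) := Real.sqrt_pos.2 (by positivity)
  have hA : 0 < (1 + σ) ^ 2 / Real.sqrt (2 * (1 + σ ^ 2)) :=
    div_pos (pow_pos (by linarith [hσ.1]) 2) hc
  have hB : 0 ≤ (1 - σ) ^ 2 / Real.sqrt (2 * (1 + σ ^ 2)) := by positivity
  have hAB : (1 - σ) ^ 2 / Real.sqrt (2 * (1 + σ ^ 2)) <
      (1 + σ) ^ 2 / Real.sqrt (2 * (1 + σ ^ 2)) :=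
    div_lt_div_of_pos_right (by nlinarith [hσ.1]) hc
  unfold boundaryFn
  generalize (1 + σ) ^ 2 / Real.sqrt (2 * (1 + σ ^ 2)) = p at *
  generalize (1 - σ) ^ 2 / Real.sqrt (2 * (1 + σ ^ 2)) = q at *
  rw [neg_div, neg_sq, neg_div, neg_sq]
  split_ifs <;> first | rfl | (exfalso; linarith) | linarith

theorem boundaryFn_abs {σ : ℝ} (hσ : σ ∈ Set.Ioc (0 : ℝ) 1) (x : ℝ) :
    boundaryFn σ |x| = boundaryFn σ x := by
  rcases le_total 0 x with h | h
  · rw [abs_of_nonneg h]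
  · rw [abs_of_nonpos h, ← boundaryFn_neg hσ (neg_nonneg.2 h), neg_neg]

/-- The boundary function on the non-negative half axis. -/
theorem boundaryFn_of_nonneg {σ x : ℝ} (hσ : σ ∈ Set.Ioc (0 : ℝ) 1) (hx : 0 ≤ x) :
    boundaryFn σ x =
      if x < (1 - σ) ^ 2 / Real.sqrt (2 * (1 + σ ^ 2)) then
        (1 + σ) * Real.sqrt (1 - (x / (1 - σ)) ^ 2)
      else if x < (1 + σ) ^ 2 / Real.sqrt (2 * (1 + σ ^ 2)) then
        Real.sqrt (2 * (1 + σ ^ 2)) - x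
      else (1 - σ) * Real.sqrt (1 - (x / (1 + σ)) ^ 2) := by
  have hc : 0 < Real.sqrt (2 * (1 + σ ^ 2)) := Real.sqrt_pos.2 (by positivity)
  have hA : 0 < (1 + σ) ^ 2 / Real.sqrt (2 * (1 + σ ^ 2)) :=
    div_pos (pow_pos (by linarith [hσ.1]) 2) hc
  have hB : 0 ≤ (1 - σ) ^ 2 / Real.sqrt (2 * (1 + σ ^ 2)) := by positivity
  unfold boundaryFn
  generalize (1 + σ) ^ 2 / Real.sqrt (2 * (1 + σ ^ 2)) = p at *
  generalize (1 - σ) ^ 2 / Real.sqrt (2 * (1 + σ ^ 2)) = q at *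
  -- The branch `√(2(1 + σ²)) + x` occurs here only for `x = 0` and `σ = 1`, where it agrees with
  -- `√(2(1 + σ²)) - x`.
  split_ifs <;> first | rfl | (exfalso; linarith) | linarith

/-- The hull lies below its support lines: the support function of the hull is the larger of the
support functions of the two ellipses. -/
theorem linear_le_of_mem_ellipseHull {σ u v h : ℝ} {z : ℂ} (hz : z ∈ ellipseHull σ) (hh : 0 ≤ h)
    (h1 : ((1 + σ) * u) ^ 2 + ((1 - σ) * v) ^ 2 ≤ h ^ 2)
    (h2 : ((1 - σ) * u) ^ 2 + ((1 + σ) * v) ^ 2 ≤ h ^ 2) : z.re * u + z.im * v ≤ h := by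
  have hcs : ∀ s, ((1 + s) * u) ^ 2 + ((1 - s) * v) ^ 2 ≤ h ^ 2 →
      hoppingEllipse s ⊆ {z : ℂ | z.re * u + z.im * v ≤ h} := by
    intro s hs
    rw [hoppingEllipse_eq_image]
    rintro _ ⟨w, hw, rfl⟩
    have hw1 : w.re ^ 2 + w.im ^ 2 = 1 := by
      have := Complex.sq_norm w
      rw [mem_sphere_zero_iff_norm.1 hw, Complex.normSq_apply] at this
      linarith
    rw [Set.mem_ofPred_eq, hopMap_re, hopMap_im]
    refine le_of_sq_le_sq ?_ hh
    -- Lagrange's identity: this square is the deficit in Cauchy–Schwarz.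
    nlinarith [sq_nonneg ((1 + s) * u * w.im - (1 - s) * v * w.re)]
  have hconv : Convex ℝ {z : ℂ | z.re * u + z.im * v ≤ h} := by
    refine convex_halfSpace_le (f := fun z : ℂ => z.re * u + z.im * v) ⟨?_, ?_⟩ h
    · intro z w; simp; ring
    · intro c z; simp; ring
  refine convexHull_min (Set.union_subset (hcs σ h1) (hcs (-σ) ?_)) hconv hz
  convert h2 using 3 <;> ring

/-- The real-linear map `x + iy ↦ x ± iy` and its negative preserve the hull. -/
theorem ellipseHull_reflect {σ ε δ : ℝ} (hε : ε = 1 ∨ ε = -1) (hδ : δ = 1 ∨ δ = -1) {z : ℂ}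
    (hz : z ∈ ellipseHull σ) : (⟨ε * z.re, δ * z.im⟩ : ℂ) ∈ ellipseHull σ := by
  let T : ℂ →ₗ[ℝ] ℂ :=
    { toFun := fun z => ⟨ε * z.re, δ * z.im⟩
      map_add' := fun z w => by apply Complex.ext <;> simp <;> ring
      map_smul' := fun c z => by apply Complex.ext <;> simp <;> ring }
  have hT : ∀ s, s = σ ∨ s = -σ → hoppingEllipse s ⊆ T ⁻¹' ellipseHull σ := by
    intro s hs
    rw [hoppingEllipse_eq_image]
    rintro _ ⟨w, hw, rfl⟩
    have : T (hopMap s w) = hopMap s ⟨ε * w.re, δ * w.im⟩ := by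
      apply Complex.ext <;> simp only [T, LinearMap.coe_mk, AddHom.coe_mk, hopMap_re, hopMap_im]
        <;> ring
    rw [Set.mem_preimage, this]
    refine hopMap_mem_ellipseHull hs ?_
    rw [← sq_le_one_iff₀ (norm_nonneg _), Complex.sq_norm, Complex.normSq_apply]
    have hw1 := Complex.sq_norm w
    rw [mem_sphere_zero_iff_norm.1 hw, Complex.normSq_apply] at hw1
    rcases hε with rfl | rfl <;> rcases hδ with rfl | rfl <;> simp <;> linarith
  exact convexHull_min (Set.union_subset (hT σ (Or.inl rfl)) (hT (-σ) (Or.inr rfl)))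
    ((convex_ellipseHull σ).linear_preimage T) hz

theorem mk_abs_mem_ellipseHull_iff {σ : ℝ} {z : ℂ} :
    (⟨|z.re|, |z.im|⟩ : ℂ) ∈ ellipseHull σ ↔ z ∈ ellipseHull σ := by
  have hsgn : ∀ x : ℝ, ∃ ε : ℝ, (ε = 1 ∨ ε = -1) ∧ |x| = ε * x ∧ x = ε * |x| := by
    intro x
    rcases abs_choice x with h | h
    · exact ⟨1, Or.inl rfl, by simpa using h, by simpa using h.symm⟩
    · exact ⟨-1, Or.inr rfl, by simpa using h, by simp [h]⟩
  obtain ⟨ε, hε, h1, h2⟩ := hsgn z.re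
  obtain ⟨δ, hδ, h3, h4⟩ := hsgn z.im
  constructor <;> intro h
  · have := ellipseHull_reflect hε hδ h
    rwa [← h2, ← h4] at this
  · have := ellipseHull_reflect hε hδ h
    rwa [← h1, ← h3] at this

/-- On each arc, `(u, v)` is the normal of the tangent at the boundary point over `z.re`, scaled so
that this ellipse has support value `1`. The squared support values of the two ellipses differ by
`4σ(u² - v²)`, so the other ellipse lies below the same line once `u²` and `v²` compare correctly;
the breakpoints of `f` are where `u² = v²`. For normal `(1, 1)` both support values are `√(2(1 +
σ²))`. -/
theorem im_le_boundaryFn {σ : ℝ} (hσ : σ ∈ Set.Ioc (0 : ℝ) 1) {z : ℂ} (hz : z ∈ ellipseHull σ)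
    (hx : 0 ≤ z.re) (hy : 0 ≤ z.im) : z.im ≤ boundaryFn σ z.re ∧ z.re ≤ 1 + σ := by
  obtain ⟨h0, h1⟩ := hσ
  have hre : z.re ≤ 1 + σ := by
    have := linear_le_of_mem_ellipseHull (u := 1) (v := 0) (h := 1 + σ) hz (by linarith)
      (by nlinarith) (by nlinarith)
    linarith
  refine ⟨?_, hre⟩
  rw [boundaryFn_of_nonneg ⟨h0, h1⟩ hx]
  have hc2 : Real.sqrt (2 * (1 + σ ^ 2)) ^ 2 = 2 * (1 + σ ^ 2) := Real.sq_sqrt (by positivity)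
  have hc : 0 < Real.sqrt (2 * (1 + σ ^ 2)) := Real.sqrt_pos.2 (by positivity)
  generalize Real.sqrt (2 * (1 + σ ^ 2)) = c at *
  have hmid : z.re + z.im ≤ c := by
    have := linear_le_of_mem_ellipseHull (u := 1) (v := 1) (h := c) hz hc.le
      (by linarith) (by linarith)
    linarith
  have ha : 0 < 1 + σ := by linarith
  split_ifs with hB hA
  · have hb : 0 < 1 - σ := by
      rcases h1.lt_or_eq with h | rfl
      · linarith
      · simp at hB; linarith
    have hxc : z.re * c < (1 - σ) ^ 2 := (lt_div_iff₀ hc).1 hB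
    have hxx := pow_le_pow_left₀ (mul_nonneg hx hc.le) hxc.le 2
    have hx1 : (z.re / (1 - σ)) ^ 2 * c ^ 2 ≤ (1 - σ) ^ 2 := by
      rw [div_pow, div_mul_eq_mul_div, div_le_iff₀ (by positivity)]
      linarith
    have hu : (z.re / (1 - σ) ^ 2) ^ 2 * c ^ 2 ≤ 1 := by
      rw [div_pow, div_mul_eq_mul_div, div_le_iff₀ (by positivity)]
      linarith
    have hpu : (1 - σ) * (z.re / (1 - σ) ^ 2) = z.re / (1 - σ) := by field_simp
    have hxu : z.re * (z.re / (1 - σ) ^ 2) = (z.re / (1 - σ)) ^ 2 := by field_simp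
    generalize z.re / (1 - σ) ^ 2 = u at *
    generalize z.re / (1 - σ) = p at *
    have hpos : 0 < 1 - p ^ 2 := by
      by_contra! hcon
      have := mul_nonneg (sub_nonneg.2 (sub_nonpos.1 hcon)) (sq_nonneg c)
      nlinarith [sq_nonneg (1 + σ)]
    have hr0 : 0 < Real.sqrt (1 - p ^ 2) := Real.sqrt_pos.2 hpos
    have hr2 : Real.sqrt (1 - p ^ 2) ^ 2 = 1 - p ^ 2 := Real.sq_sqrt hpos.le
    generalize Real.sqrt (1 - p ^ 2) = r at *
    have hv : 1 ≤ (r / (1 + σ)) ^ 2 * c ^ 2 := by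
      rw [div_pow, div_mul_eq_mul_div, le_div_iff₀ (by positivity), hr2]
      linarith
    have hav : (1 + σ) * (r / (1 + σ)) = r := mul_div_cancel₀ _ ha.ne'
    have hyv : z.im * r = (1 + σ) * (z.im * (r / (1 + σ))) := by field_simp
    generalize r / (1 + σ) = v at *
    have huv : u ^ 2 ≤ v ^ 2 := le_of_mul_le_mul_right (hu.trans hv) (by positivity)
    have heq : ((1 - σ) * u) ^ 2 + ((1 + σ) * v) ^ 2 = 1 := by
      rw [hpu, hav, hr2]
      ring
    have hle := linear_le_of_mem_ellipseHull (u := u) (v := v) (h := 1) hz zero_le_one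
      (by linarith [mul_le_mul_of_nonneg_left huv h0.le]) (by linarith)
    have h3 := mul_le_mul_of_nonneg_left (show z.im * v ≤ r ^ 2 by linarith) ha.le
    exact le_of_mul_le_mul_right (by linarith) hr0
  · linarith
  · rw [not_lt] at hA
    have hxc : (1 + σ) ^ 2 ≤ z.re * c := (div_le_iff₀ hc).1 hA
    rcases hre.lt_or_eq with hlt | heq
    · have hb : 0 < 1 - σ := by
        rcases h1.lt_or_eq with h | rfl
        · linarith
        · nlinarith
      have hxx := pow_le_pow_left₀ (sq_nonneg _) hxc 2
      have hp1 : z.re / (1 + σ) < 1 := (div_lt_one ha).2 hlt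
      have hp0 : 0 ≤ z.re / (1 + σ) := by positivity
      have hx1 : (1 + σ) ^ 2 ≤ (z.re / (1 + σ)) ^ 2 * c ^ 2 := by
        rw [div_pow, div_mul_eq_mul_div, le_div_iff₀ (by positivity)]
        linarith
      have hu : 1 ≤ (z.re / (1 + σ) ^ 2) ^ 2 * c ^ 2 := by
        rw [div_pow, div_mul_eq_mul_div, le_div_iff₀ (by positivity)]
        linarith
      have hpu : (1 + σ) * (z.re / (1 + σ) ^ 2) = z.re / (1 + σ) := by field_simp
      have hxu : z.re * (z.re / (1 + σ) ^ 2) = (z.re / (1 + σ)) ^ 2 := by field_simp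
      generalize z.re / (1 + σ) ^ 2 = u at *
      generalize z.re / (1 + σ) = p at *
      have hpos : 0 < 1 - p ^ 2 := by nlinarith
      have hr0 : 0 < Real.sqrt (1 - p ^ 2) := Real.sqrt_pos.2 hpos
      have hr2 : Real.sqrt (1 - p ^ 2) ^ 2 = 1 - p ^ 2 := Real.sq_sqrt hpos.le
      generalize Real.sqrt (1 - p ^ 2) = r at *
      have hv : (r / (1 - σ)) ^ 2 * c ^ 2 ≤ 1 := by
        rw [div_pow, div_mul_eq_mul_div, div_le_iff₀ (by positivity), hr2]
        linarith
      have hav : (1 - σ) * (r / (1 - σ)) = r := mul_div_cancel₀ _ hb.ne'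
      have hyv : z.im * r = (1 - σ) * (z.im * (r / (1 - σ))) := by field_simp
      generalize r / (1 - σ) = v at *
      have huv : v ^ 2 ≤ u ^ 2 := le_of_mul_le_mul_right (hv.trans hu) (by positivity)
      have heq : ((1 + σ) * u) ^ 2 + ((1 - σ) * v) ^ 2 = 1 := by
        rw [hpu, hav, hr2]
        ring
      have hle := linear_le_of_mem_ellipseHull (u := u) (v := v) (h := 1) hz zero_le_one (by linarith)
        (by linarith [mul_le_mul_of_nonneg_left huv h0.le])
      have h3 := mul_le_mul_of_nonneg_left (show z.im * v ≤ r ^ 2 by linarith) hb.le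
      exact le_of_mul_le_mul_right (by linarith) hr0
    -- At the vertex the tangent is vertical and does not bound `z.im`. If `z.im > 0`, the tilted
    -- normal `(1, z.im)` gives a contradiction; `z.im ≤ 1 - σ` ensures that the wide ellipse
    -- determines the support value.
    · rw [heq, div_self ha.ne']
      simp only [one_pow, sub_self, Real.sqrt_zero, mul_zero]
      by_contra! hpos
      have hcab : c ≤ 2 := by nlinarith
      have hy1 : z.im ≤ 1 - σ := by nlinarith
      have hS : 0 ≤ ((1 + σ) * 1) ^ 2 + ((1 - σ) * z.im) ^ 2 := by positivity
      have := linear_le_of_mem_ellipseHull (u := 1) (v := z.im)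
        (h := Real.sqrt (((1 + σ) * 1) ^ 2 + ((1 - σ) * z.im) ^ 2)) hz (Real.sqrt_nonneg _)
        (Real.sq_sqrt hS).ge (by
          rw [Real.sq_sqrt hS]
          nlinarith [mul_nonneg h0.le (show 0 ≤ 1 - z.im ^ 2 by nlinarith)])
      rw [heq, Real.le_sqrt (by positivity) hS] at this
      nlinarith [sq_pos_of_pos hpos, sq_nonneg (z.im ^ 2)]

theorem mem_ellipseHull_of_ellipse {σ s x y : ℝ} (hs : s = σ ∨ s = -σ)
    {p q : ℝ} (hx : x = (1 + s) * p) (hy : y = (1 - s) * q) (h : p ^ 2 + q ^ 2 ≤ 1) :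
    (⟨x, y⟩ : ℂ) ∈ ellipseHull σ := by
  have := hopMap_mem_ellipseHull hs (w := ⟨p, q⟩) (by
    rw [← sq_le_one_iff₀ (norm_nonneg _), Complex.sq_norm, Complex.normSq_apply]
    simpa [← sq] using h)
  convert this using 1
  apply Complex.ext <;> simp [hopMap_re, hopMap_im, hx, hy]

/-- The point lies on the segment from `(x, y')` to its mirror image `(x, -y')`. -/
theorem mk_mem_ellipseHull_of_le {σ x y y' : ℝ} (hy : 0 ≤ y) (hyy' : y ≤ y')
    (h : (⟨x, y'⟩ : ℂ) ∈ ellipseHull σ) : (⟨x, y⟩ : ℂ) ∈ ellipseHull σ := by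
  rcases hy.eq_or_lt with rfl | hpos
  · have := (convex_ellipseHull σ) h (ellipseHull_reflect (Or.inl rfl) (Or.inr rfl) h)
      (a := 1 / 2) (b := 1 / 2) (by norm_num) (by norm_num) (by norm_num)
    convert this using 1
    apply Complex.ext <;> simp
    ring
  · have hy' : 0 < y' := hpos.trans_le hyy'
    have hyd : y / y' ≤ 1 := (div_le_one hy').2 hyy'
    have := (convex_ellipseHull σ) h (ellipseHull_reflect (Or.inl rfl) (Or.inr rfl) h)
      (a := (1 + y / y') / 2) (b := (1 - y / y') / 2) (by positivity) (by linarith) (by ring)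
    convert this using 1
    apply Complex.ext <;> simp <;> field_simp <;> ring

theorem mem_ellipseHull_of_le_boundaryFn {σ : ℝ} (hσ : σ ∈ Set.Ioc (0 : ℝ) 1) {x y : ℝ}
    (hx : 0 ≤ x) (hxa : x ≤ 1 + σ) (hy : 0 ≤ y) (hyf : y ≤ boundaryFn σ x) :
    (⟨x, y⟩ : ℂ) ∈ ellipseHull σ := by
  refine mk_mem_ellipseHull_of_le hy hyf ?_
  rw [boundaryFn_of_nonneg hσ hx]
  obtain ⟨h0, h1⟩ := hσ
  have hc2 : Real.sqrt (2 * (1 + σ ^ 2)) ^ 2 = 2 * (1 + σ ^ 2) := Real.sq_sqrt (by positivity)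
  have hc : 0 < Real.sqrt (2 * (1 + σ ^ 2)) := Real.sqrt_pos.2 (by positivity)
  generalize Real.sqrt (2 * (1 + σ ^ 2)) = c at *
  have ha : 0 < 1 + σ := by linarith
  split_ifs with hB hA
  · have hxc : x * c < (1 - σ) ^ 2 := (lt_div_iff₀ hc).1 hB
    have hb : 0 < 1 - σ := by
      rcases h1.lt_or_eq with h | rfl
      · linarith
      · simp at hB; linarith
    have hxb : x ≤ 1 - σ := by
      by_contra! hcon
      nlinarith [mul_pos hc hb]
    refine mem_ellipseHull_of_ellipse (s := -σ) (Or.inr rfl) (p := x / (1 - σ))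
      (q := Real.sqrt (1 - (x / (1 - σ)) ^ 2)) ?_ (by ring) ?_
    · rw [← sub_eq_add_neg, mul_div_cancel₀ _ hb.ne']
    · rw [Real.sq_sqrt]
      · linarith
      · rw [sub_nonneg]
        exact pow_le_one₀ (by positivity) ((div_le_one hb).2 hxb)
  · rw [not_lt, div_le_iff₀ hc] at hB
    rw [lt_div_iff₀ hc] at hA
    -- `P` and `Q` are the points where the common tangent touches the ellipses; the weights below
    -- are read off from the abscissa, as `P.re - Q.re = 4σ/c`.
    have hP : (⟨(1 + σ) ^ 2 / c, (1 - σ) ^ 2 / c⟩ : ℂ) ∈ ellipseHull σ := by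
      refine mem_ellipseHull_of_ellipse (s := σ) (Or.inl rfl) (p := (1 + σ) / c)
        (q := (1 - σ) / c) (by ring) (by ring) ?_
      rw [div_pow, div_pow, ← add_div, div_le_one (by positivity)]
      linarith
    have hQ : (⟨(1 - σ) ^ 2 / c, (1 + σ) ^ 2 / c⟩ : ℂ) ∈ ellipseHull σ := by
      refine mem_ellipseHull_of_ellipse (s := -σ) (Or.inr rfl) (p := (1 - σ) / c)
        (q := (1 + σ) / c) (by ring) (by ring) ?_
      rw [div_pow, div_pow, ← add_div, div_le_one (by positivity)]
      linarith
    have := (convex_ellipseHull σ) hP hQ (a := (x * c - (1 - σ) ^ 2) / (4 * σ))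
      (b := ((1 + σ) ^ 2 - x * c) / (4 * σ)) (div_nonneg (by linarith) (by linarith))
      (div_nonneg (by linarith) (by linarith)) (by field_simp; ring)
    convert this using 1
    apply Complex.ext <;> simp only [Complex.add_re, Complex.add_im, Complex.smul_re,
      Complex.smul_im, smul_eq_mul] <;> field_simp
    · ring
    · linear_combination 4 * σ * hc2
  · refine mem_ellipseHull_of_ellipse (s := σ) (Or.inl rfl) (p := x / (1 + σ))
      (q := Real.sqrt (1 - (x / (1 + σ)) ^ 2)) ?_ rfl ?_
    · rw [mul_div_cancel₀ _ ha.ne']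
    · rw [Real.sq_sqrt]
      · linarith
      · rw [sub_nonneg]
        exact pow_le_one₀ (by positivity) ((div_le_one ha).2 hxa)

theorem ellipseHull_eq {σ : ℝ} (hσ : σ ∈ Set.Ioc (0 : ℝ) 1) :
    ellipseHull σ = {z : ℂ | (-boundaryFn σ z.re ≤ z.im ∧ z.im ≤ boundaryFn σ z.re) ∧
      (-(1 + σ) ≤ z.re ∧ z.re ≤ 1 + σ)} := by
  ext z
  rw [Set.mem_ofPred_eq, ← abs_le, ← abs_le, ← boundaryFn_abs hσ z.re,
    ← mk_abs_mem_ellipseHull_iff]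
  exact ⟨fun h => im_le_boundaryFn hσ h (abs_nonneg _) (abs_nonneg _), fun h =>
    mem_ellipseHull_of_le_boundaryFn hσ (abs_nonneg _) h.2 (abs_nonneg _) h.1⟩

/-! ### Lower bound: finite patterns fill the hull -/

/-- The values at unit vectors `x` supported in `{1, …, N - 1}` of the quadratic forms of the
one-sided tridiagonal matrices with superdiagonal `1` and subdiagonal in `{σ, -σ}`. -/
def finiteFormValues (σ : ℝ) : Set ℂ :=
  {z | ∃ (N : ℕ) (s : ℕ → ℝ) (x : ℕ → ℂ), (∀ i, s i = σ ∨ s i = -σ) ∧ x 0 = 0 ∧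
    (∀ i, N ≤ i → x i = 0) ∧ ∑ i ∈ Finset.range N, ‖x i‖ ^ 2 = 1 ∧
    z = ∑ i ∈ Finset.range N, hopMap (s i) (conj (x i) * x (i + 1))}

/-- The vectors `√a x` and `√b y` are placed on adjacent blocks. Since `y 0 = 0`, the bond between
the blocks contributes nothing, so the two forms add. -/
theorem convex_finiteFormValues (σ : ℝ) : Convex ℝ (finiteFormValues σ) := by
  rintro _ ⟨N, s, x, hs, hx0, hxN, hx1, rfl⟩ _ ⟨M, s', y, hs', hy0, hyM, hy1, rfl⟩ a b ha hb hab
  have hr : ∀ {r : ℝ}, 0 ≤ r → ∀ u v : ℂ,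
      conj ((Real.sqrt r : ℂ) * u) * ((Real.sqrt r : ℂ) * v) = r • (conj u * v) := by
    intro r hr u v
    rw [map_mul, Complex.conj_ofReal, Complex.real_smul]
    nth_rewrite 3 [← Real.mul_self_sqrt hr]
    push_cast
    ring
  have hn : ∀ {r : ℝ}, 0 ≤ r → ∀ u : ℂ, ‖(Real.sqrt r : ℂ) * u‖ ^ 2 = r * ‖u‖ ^ 2 := by
    intro r hr u
    rw [norm_mul, mul_pow, Complex.norm_real, Real.norm_eq_abs, sq_abs, Real.sq_sqrt hr]
  refine ⟨N + M, fun i => if i < N then s i else s' (i - N),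
    fun i => if i < N then (Real.sqrt a : ℂ) * x i else (Real.sqrt b : ℂ) * y (i - N),
    fun i => ?_, ?_, fun i hi => ?_, ?_, ?_⟩
  · dsimp only
    split_ifs
    exacts [hs _, hs' _]
  · dsimp only
    split_ifs <;> simp [hx0, hy0]
  · dsimp only
    rw [if_neg (by omega), hyM _ (by omega), mul_zero]
  · rw [Finset.sum_range_add, Finset.sum_congr rfl (g := fun i => a * ‖x i‖ ^ 2),
      Finset.sum_congr rfl (s₁ := Finset.range M) (g := fun i => b * ‖y i‖ ^ 2),
      ← Finset.mul_sum, ← Finset.mul_sum, hx1, hy1]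
    · linarith
    · intro i _
      dsimp only
      rw [if_neg (by omega), Nat.add_sub_cancel_left, hn hb]
    · intro i hi
      dsimp only
      rw [if_pos (Finset.mem_range.1 hi), hn ha]
  · rw [Finset.sum_range_add, Finset.smul_sum, Finset.smul_sum]
    congr 1
    · refine Finset.sum_congr rfl fun i hi => ?_
      rw [Finset.mem_range] at hi
      dsimp only
      rw [if_pos hi, if_pos hi, ← map_smul, ← hr ha]
      split_ifs with h
      · rfl
      · rw [hxN _ (not_lt.1 h), show i + 1 - N = 0 by omega, hy0, mul_zero, mul_zero, mul_zero,
          mul_zero]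
    · refine Finset.sum_congr rfl fun i _ => ?_
      dsimp only
      rw [if_neg (by omega), if_neg (by omega), if_neg (by omega), Nat.add_sub_cancel_left,
        show N + i + 1 - N = i + 1 by omega, ← map_smul, ← hr hb]

/-- Truncated plane waves approximate the points of the ellipses. -/
theorem hoppingEllipse_subset_closure {σ s : ℝ} (hs : s = σ ∨ s = -σ) :
    hoppingEllipse s ⊆ closure (finiteFormValues σ) := by
  rw [hoppingEllipse_eq_image]
  rintro _ ⟨w, hw, rfl⟩
  rw [mem_sphere_zero_iff_norm] at hw
  have hlim : Filter.Tendsto (fun n : ℕ => ((n : ℝ) / (n + 1)) • hopMap s w) Filter.atTop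
      (nhds (hopMap s w)) := by
    simpa using (tendsto_natCast_div_add_atTop (1 : ℝ)).smul_const (hopMap s w)
  refine mem_closure_of_tendsto hlim (Filter.Eventually.of_forall fun n => ?_)
  have hn : (0 : ℝ) < n + 1 := by positivity
  -- The wave occupies the `n + 1` sites `1, …, n + 1`, which have only `n` bonds between them;
  -- hence the factor `n / (n + 1)`.
  refine ⟨n + 2, fun _ => s,
    fun i => if i = 0 ∨ n + 2 ≤ i then 0 else ((Real.sqrt (n + 1))⁻¹ : ℝ) * w ^ i,
    fun _ => hs, by simp, fun i hi => if_pos (Or.inr hi), ?_, ?_⟩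
  · rw [Finset.sum_range_succ', Finset.sum_congr rfl (g := fun _ => ((n : ℝ) + 1)⁻¹)]
    · simp
      field_simp
    · intro i hi
      rw [Finset.mem_range] at hi
      dsimp only
      rw [if_neg (by omega), norm_mul, norm_pow, hw, one_pow, mul_one, Complex.norm_real,
        Real.norm_eq_abs, sq_abs, inv_pow, Real.sq_sqrt hn.le]
  · rw [Finset.sum_range_succ', Finset.sum_range_succ,
      Finset.sum_congr rfl (g := fun _ => ((n : ℝ) + 1)⁻¹ • hopMap s w)]
    · simp
      ring
    · intro i hi
      rw [Finset.mem_range] at hi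
      dsimp only
      rw [if_neg (by omega), if_neg (by omega), ← map_smul]
      congr 1
      have hww : conj w * w = 1 := by
        rw [← Complex.normSq_eq_conj_mul_self, Complex.normSq_eq_norm_sq, hw]; simp
      have hsq : (((Real.sqrt (n + 1))⁻¹ : ℝ) : ℂ) * ((Real.sqrt (n + 1))⁻¹ : ℝ) =
          (((n : ℝ) + 1)⁻¹ : ℝ) := by
        rw [← Complex.ofReal_mul, ← mul_inv, Real.mul_self_sqrt hn.le]
      rw [map_mul, Complex.conj_ofReal, map_pow, Complex.real_smul, ← hsq, pow_succ w (i + 1)]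
      calc _ = (((Real.sqrt (n + 1))⁻¹ : ℝ) : ℂ) * ((Real.sqrt (n + 1))⁻¹ : ℝ) *
            (conj w * w) ^ (i + 1) * w := by ring
        _ = _ := by rw [hww]; ring

/-- The tridiagonal matrix with superdiagonal `1` and subdiagonal `s`. -/
def hoppingMatrix (s : ℕ → ℝ) (N : ℕ) : Matrix (Fin N) (Fin N) ℂ :=
  Matrix.of fun i j =>
    if (j : ℕ) = i + 1 then 1 else if (i : ℕ) = j + 1 then (s j : ℂ) else 0

theorem hoppingMatrix_mem {σ : ℝ} {s : ℕ → ℝ} (hs : ∀ i, s i = σ ∨ s i = -σ) (N : ℕ) :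
    hoppingMatrix s N ∈ finiteBandMatrices (-1) 1 (hoppingSets σ) N := by
  intro i j
  rw [hoppingMatrix, Matrix.of_apply]
  split_ifs with h1 h2
  · rw [show (i : ℤ) - j = -1 by omega]
    simp [AllowedEntry, hoppingSets]
  · rw [show (i : ℤ) - j = 1 by omega]
    rcases hs j with h | h <;> simp [AllowedEntry, hoppingSets, h]
  · refine ⟨fun h => ?_, fun _ => rfl⟩
    rw [show (i : ℤ) - j = 0 by omega]
    simp [hoppingSets]

/-- The subdiagonal entry of row `j + 1` is counted at column `j`, which collects both terms of a
bond; bonds leaving the block vanish by `hx`. -/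
theorem sum_hoppingMatrix (s : ℕ → ℝ) {N : ℕ} {x : ℕ → ℂ} (hx : ∀ i, N ≤ i → x i = 0) :
    ∑ i : Fin N, conj (x i) * ∑ j : Fin N, hoppingMatrix s N i j * x j =
      ∑ i ∈ Finset.range N, hopMap (s i) (conj (x i) * x (i + 1)) := by
  have hsplit : ∀ i j : Fin N, conj (x i) * (hoppingMatrix s N i j * x j) =
      (if (j : ℕ) = i + 1 then conj (x i) * x (i + 1) else 0) +
      (if (i : ℕ) = j + 1 then s j * (conj (x (j + 1)) * x j) else 0) := by
    intro i j
    rw [hoppingMatrix, Matrix.of_apply]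
    split_ifs with h1 h2 h2
    · omega
    · rw [h1]; ring
    · rw [h2]; ring
    · ring
  have hone : ∀ (i : Fin N) (a : ℂ), (N ≤ (i : ℕ) + 1 → a = 0) →
      ∑ j : Fin N, (if (j : ℕ) = i + 1 then a else 0) = a := by
    intro i a ha
    rw [← Finset.sum_range (fun j => if j = (i : ℕ) + 1 then a else 0), Finset.sum_ite_eq']
    split_ifs with h
    · rfl
    · exact (ha (by simpa using h)).symm
  simp only [Finset.mul_sum, hsplit, Finset.sum_add_distrib]
  rw [Finset.sum_comm (f := fun i j : Fin N =>
    if (i : ℕ) = j + 1 then s j * (conj (x (j + 1)) * x j) else 0), ← Finset.sum_add_distrib,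
    Finset.sum_range]
  refine Finset.sum_congr rfl fun i _ => ?_
  rw [hone i _ fun h => by rw [hx _ h, mul_zero],
    hone i _ fun h => by rw [hx _ h, map_zero, zero_mul, mul_zero], hopMap_apply,
    map_mul, Complex.conj_conj]
  ring

/-- The finite vector is transplanted to the sites `k, …, k + N - 1` where `A` nearly shows its
pattern; the values differ by the form of the error matrix, at most `ε / 2`. -/
theorem finiteFormValues_subset_numericalRange {e : HilbertBasis ℤ ℂ EllTwo} {σ : ℝ}
    {A : EllTwo →L[ℂ] EllTwo} (hA : A ∈ pseudoErgodic e (-1) 1 (hoppingSets σ)) :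
    finiteFormValues σ ⊆ numericalRange A := by
  rintro _ ⟨N, s, x, hs, -, hxN, hx1, rfl⟩
  rw [numericalRange, Metric.mem_closure_iff]
  intro ε hε
  obtain ⟨k, hk⟩ := hA.2 (ε / 2) (half_pos hε) N _ (hoppingMatrix_mem hs N)
  have hinj : Function.Injective fun j : Fin N => k + (j : ℤ) := fun i j h => by
    ext; simpa using h
  have hon := e.orthonormal.comp _ hinj
  set v : EllTwo := ∑ j : Fin N, x j • e (k + (j : ℤ)) with hv
  have hv1 : ‖v‖ = 1 := by
    have h2 : inner ℂ v v = 1 := by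
      rw [hv]
      refine (hon.inner_sum (fun j : Fin N => x j) (fun j : Fin N => x j) Finset.univ).trans ?_
      rw [← Finset.sum_range fun j => conj (x j) * x j]
      simp only [← Complex.normSq_eq_conj_mul_self, Complex.normSq_eq_norm_sq]
      exact_mod_cast hx1
    have h3 := inner_self_eq_norm_sq (𝕜 := ℂ) v
    rw [h2, RCLike.one_re] at h3
    exact (pow_eq_one_iff_of_nonneg (norm_nonneg v) two_ne_zero).1 h3.symm
  refine ⟨_, ⟨v, hv1, rfl⟩, ?_⟩
  set X : EuclideanSpace ℂ (Fin N) := WithLp.toLp 2 fun j => x j with hX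
  have hX1 : ‖X‖ = 1 := by
    rw [EuclideanSpace.norm_eq, Real.sqrt_eq_one, ← hx1, Finset.sum_range]
  have hform : inner ℂ v (A v) = ∑ i : Fin N, conj (x i) *
      ∑ j : Fin N, finiteSection e A k N i j * x j := by
    simp only [hv, map_sum, map_smul, sum_inner, inner_sum, inner_smul_left, inner_smul_right,
      Finset.mul_sum, finiteSection, entry, Matrix.of_apply]
    rw [Finset.sum_comm]
    refine Finset.sum_congr rfl fun i _ => Finset.sum_congr rfl fun j _ => ?_
    ring
  have hdiff : inner ℂ v (A v) - ∑ i ∈ Finset.range N, hopMap (s i) (conj (x i) * x (i + 1)) =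
      inner ℂ X (Matrix.toEuclideanCLM (𝕜 := ℂ)
        (finiteSection e A k N - hoppingMatrix s N) X) := by
    rw [hform, ← sum_hoppingMatrix s hxN, ← Finset.sum_sub_distrib, hX,
      Matrix.toEuclideanCLM_toLp, PiLp.inner_apply]
    refine Finset.sum_congr rfl fun i _ => ?_
    rw [← mul_sub, ← Finset.sum_sub_distrib]
    simp only [Matrix.mulVec, dotProduct, Matrix.sub_apply, sub_mul, RCLike.inner_apply]
    ring
  rw [dist_comm, dist_eq_norm, hdiff]
  calc _ ≤ ‖X‖ * ‖Matrix.toEuclideanCLM (𝕜 := ℂ)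
        (finiteSection e A k N - hoppingMatrix s N) X‖ := norm_inner_le_norm _ _
    _ ≤ ‖X‖ * (ε / 2 * ‖X‖) := by
        gcongr
        exact ContinuousLinearMap.le_of_opNorm_le _ hk X
    _ < ε := by rw [hX1]; linarith

theorem ellipseHull_subset_numericalRange {e : HilbertBasis ℤ ℂ EllTwo} {σ : ℝ}
    {A : EllTwo →L[ℂ] EllTwo} (hA : A ∈ pseudoErgodic e (-1) 1 (hoppingSets σ)) :
    ellipseHull σ ⊆ numericalRange A :=
  (convexHull_min (Set.union_subset (hoppingEllipse_subset_closure (Or.inl rfl))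
    (hoppingEllipse_subset_closure (Or.inr rfl))) (convex_finiteFormValues σ).closure).trans
    (closure_minimal (finiteFormValues_subset_numericalRange hA) isClosed_closure)

theorem mainTheorem9 (e : HilbertBasis ℤ ℂ EllTwo) (σ : ℝ) (hσ : σ ∈ Set.Ioc (0 : ℝ) 1)
    (A : EllTwo →L[ℂ] EllTwo) (hA : A ∈ pseudoErgodic e (-1) 1 (hoppingSets σ)) :
    numericalRange A =
      {z : ℂ | (-boundaryFn σ z.re ≤ z.im ∧ z.im ≤ boundaryFn σ z.re) ∧
        (-(1 + σ) ≤ z.re ∧ z.re ≤ 1 + σ)} ∧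
    numericalRange A = convexHull ℝ (hoppingEllipse σ ∪ hoppingEllipse (-σ)) := by
  have h : numericalRange A = ellipseHull σ :=
    (numericalRange_subset_ellipseHull hA.1).antisymm (ellipseHull_subset_numericalRange hA)
  exact ⟨h.trans (ellipseHull_eq hσ), h⟩
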